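/- Let $N$ and $k$ be integers with $1\le k\le N-2$, let $X_1,\dots,X_N$ be independent random variables, each uniformly distributed on $[0,1]$, and let $X_{(1)}\le\dots\le X_{(N)}$ be their order statistics. Let $G^f_j=X_{(j+1)}-X_{(j)}$ for $1\le j\le N-1$ be the inner spacings (the boundary points $0$ and $1$ are not used), let $G^f_{(1)}\le\dots\le G^f_{(N-1)}$ be these spacings in increasing order, and let $$S_k=\sum_{j=1}^{k}G^f_{(N-j)}$$ be the sum of the $k$ largest of them. Put $$A(m,M)=\frac{M\,(M+1)!}{(M+1-m)^{m-1}(M+1-m)!},\qquad a(i,m)=\frac{(-1)^{i-1}(m+1-i)^{m-2}}{(m-i)!\,(i-1)!},$$ and $H(x,a,b)=1$ if $a\le x\le b$ and $H(x,a,b)=0$ otherwise. Then the law of $S_k$ is absolutely continuous with a density that vanishes outside $[0,1]$ and equals, for $0\le s\le 1$, the nonnegative function $$\begin{aligned}p(s)&=N(N-1)A(N-1-k,N-2)\sum_{i=1}^{N-1-k}\int_{s}^{\min\left(1,\frac{s(N-i)}{k}\right)}a(i,N-1-k)(1-\mu)\left[\frac{s(N-i)-\mu k}{N-k-i}\right]^{N-3}d\mu\\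 &=\frac{N\,A(N-1-k,N-2)}{k^2(N-2)}\sum_{i=1}^{N-1-k}\frac{a(i,N-1-k)}{(N-k-i)^{N-3}}\Big(s^{N-2}\,[k(N-1)-s(N-i)-ks(N-2)]\,[N-i-k]^{N-2}\\ &\qquad\qquad+[s(N-i)-k]^{N-1}\,H\big(s,\tfrac{k}{N-i},1\big)\Big),\end{aligned}$$ and for $0\le s\le 1$ the cumulative distribution function is $$\begin{aligned}P(S_k\le s)&=\frac{N\,A(N-1-k,N-2)}{k^2(N-2)}\sum_{i=1}^{N-1-k}\frac{a(i,N-1-k)}{(N-k-i)^{N-3}}\Big(s^{N-1}\Big[k-\frac{s\,[N(k+1)-i-2k]}{N}\Big][N-i-k]^{N-2}\\ &\qquad\qquad+\frac{1}{N(N-i)}\,[s(N-i)-k]^{N}\,H\big(s,\tfrac{k}{N-i},1\big)\Big).\end{aligned}$$ (Here $0^0=1$.) -/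

import Mathlib

open MeasureTheory ProbabilityTheory

/-- Order statistics of a finite family of reals, in increasing order. The indices start at `0`:
`orderStat x ⟨j, _⟩` is the `(j + 1)`-th smallest of the values `x 0, …, x (n - 1)`, counted with
multiplicity. -/
noncomputable def orderStat {n : ℕ} (x : Fin n → ℝ) : Fin n → ℝ :=
  x ∘ Tuple.sort x

/-- The `n - 1` inner spacings of `n` points: the differences of neighbouring order statistics.
The boundary points `0` and `1` are not used. -/
noncomputable def innerSpacing {n : ℕ} (x : Fin n → ℝ) (j : Fin (n - 1)) : ℝ :=
  orderStat x ⟨j.val + 1, by omega⟩ - orderStat x ⟨j.val, by omega⟩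

/-- Sum of the `k` largest of the `m` numbers `g 0, …, g (m - 1)`, that is, of their order
statistics with (zero-based) indices `m - k, …, m - 1`. -/
noncomputable def sumLargest {m : ℕ} (k : ℕ) (g : Fin m → ℝ) : ℝ :=
  ∑ j : Fin m with m ≤ j.val + k, orderStat g j

/-- `A(k, N) = N (N+1)! / ((N+1-k)^(k-1) (N+1-k)!)`, used for `1 ≤ k ≤ N`. -/
noncomputable def coeffA (k N : ℕ) : ℝ :=
  ((N : ℝ) * ((N + 1).factorial : ℝ)) /
    (((N : ℝ) + 1 - (k : ℝ)) ^ (k - 1) * ((N + 1 - k).factorial : ℝ))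

/-- `a(i, k) = (-1)^(i-1) (k+1-i)^(k-2) / ((k-i)! (i-1)!)`, used for `1 ≤ i ≤ k`. The exponent
`k - 2` is an integer, equal to `-1` when `k = 1`. -/
noncomputable def coeffa (i k : ℕ) : ℝ :=
  ((-1 : ℝ) ^ (i - 1) * ((k : ℝ) + 1 - (i : ℝ)) ^ ((k : ℤ) - 2)) /
    (((k - i).factorial : ℝ) * ((i - 1).factorial : ℝ))

/-- `H(x, a, b)` is `1` if `a ≤ x ≤ b` and `0` otherwise. -/
noncomputable def boxH (x a b : ℝ) : ℝ :=
  (Set.Icc a b).indicator (fun _ => (1 : ℝ)) x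

/-- Closed form of the density of the sum of the `k` largest inner spacings of `N` points, on
`0 ≤ s ≤ 1`. -/
noncomputable def pdfSumMax (N k : ℕ) (s : ℝ) : ℝ :=
  (N : ℝ) * coeffA (N - 1 - k) (N - 2) / ((k : ℝ) ^ 2 * ((N : ℝ) - 2)) *
    ∑ i ∈ Finset.Icc 1 (N - 1 - k),
      coeffa i (N - 1 - k) / ((N : ℝ) - k - i) ^ (N - 3) *
        (s ^ (N - 2) * ((k : ℝ) * ((N : ℝ) - 1) - s * ((N : ℝ) - i) - (k : ℝ) * s * ((N : ℝ) - 2)) *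
            ((N : ℝ) - i - k) ^ (N - 2)
          + (s * ((N : ℝ) - i) - k) ^ (N - 1) * boxH s ((k : ℝ) / ((N : ℝ) - i)) 1)

/-- Closed form of the cumulative distribution function of the sum of the `k` largest inner
spacings of `N` points, on `0 ≤ s ≤ 1`. -/
noncomputable def cdfSumMax (N k : ℕ) (s : ℝ) : ℝ :=
  (N : ℝ) * coeffA (N - 1 - k) (N - 2) / ((k : ℝ) ^ 2 * ((N : ℝ) - 2)) *
    ∑ i ∈ Finset.Icc 1 (N - 1 - k),
      coeffa i (N - 1 - k) / ((N : ℝ) - k - i) ^ (N - 3) *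
        (s ^ (N - 1) * ((k : ℝ) - s * ((N : ℝ) * ((k : ℝ) + 1) - i - 2 * (k : ℝ)) / (N : ℝ)) *
            ((N : ℝ) - i - k) ^ (N - 2)
          + 1 / ((N : ℝ) * ((N : ℝ) - i)) * (s * ((N : ℝ) - i) - k) ^ N *
              boxH s ((k : ℝ) / ((N : ℝ) - i)) 1)

open scoped ENNReal

/-! Write N = k + j + 2. The statistic is symmetric in the sample, so sorting the sample costs a
factor N!. Passing to increments preserves Lebesgue measure and leaves the smallest point a ≥ 0 and
the N - 1 spacings g ≥ 0, subject to a + Σ g ≤ 1. Integrating out a gives the spacings the weight (1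
- Σ g)⁺. This is symmetric again, so the spacings can be sorted in turn, at the cost of (N - 1)!. In
the increments of the sorted spacings, S_k is the linear form `topForm`, and the spacings left out
add up to `bottomForm`.

Everything thus reduces to the joint density of two linear forms under Lebesgue measure on an
orthant (`setLIntegral_topForm_bottomForm`). Adding one coordinate convolves this density along the
ray of direction (k, j + 2). The density stays a combination of truncated powers of s - k v / (i +
1); the coefficient of the new power is found from a vanishing finite difference
(`integral_rangeSumDensity`). Integrating against 1 - s - v in v gives the density of S_k, with μ =
s + v the range of the sample; a further integration in s gives the distribution function. -/

theorem setLIntegral_Ici_cons {n : ℕ} (f : (Fin (n + 1) → ℝ) → ℝ≥0∞) (hf : Measurable f) :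
    ∫⁻ y in Set.Ici 0, f y =
      ∫⁻ a in Set.Ici (0 : ℝ), ∫⁻ y in Set.Ici (0 : Fin n → ℝ), f (Fin.cons a y) := by
  have hmp := (volume_preserving_piFinSuccAbove (fun _ : Fin (n + 1) => ℝ) 0).symm
  have hpre : (MeasurableEquiv.piFinSuccAbove (fun _ : Fin (n + 1) => ℝ) 0).symm ⁻¹' Set.Ici 0 =
      Set.Ici (0 : ℝ) ×ˢ Set.Ici (0 : Fin n → ℝ) := by
    ext ⟨a, y⟩
    simp [Pi.le_def, Fin.forall_fin_succ]
  rw [← hmp.setLIntegral_comp_preimage measurableSet_Ici hf, hpre, Measure.volume_eq_prod,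
    ← Measure.prod_restrict, lintegral_prod]
  · simp [Fin.consEquiv]
  · exact (hf.comp (MeasurableEquiv.measurable _)).aemeasurable

/-! ### Order statistics and integrals of symmetric functions. -/

theorem measurable_orderStat {n : ℕ} : Measurable (orderStat : (Fin n → ℝ) → Fin n → ℝ) := by
  have hset : ∀ σ : Equiv.Perm (Fin n), MeasurableSet {x : Fin n → ℝ | Tuple.sort x = σ} := by
    intro σ
    -- `Tuple.sort` breaks ties by index, so each fibre is cut out by finitely many comparisons of
    -- coordinates; on a fibre, an order statistic is a coordinate.
    have : {x : Fin n → ℝ | Tuple.sort x = σ} = {x | (∀ i j, i ≤ j → x (σ i) ≤ x (σ j)) ∧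
        ∀ i j, i < j → x (σ i) = x (σ j) → σ i < σ j} := by
      ext x
      simp only [Set.mem_ofPred_eq]
      rw [eq_comm, Tuple.eq_sort_iff]
      rfl
    rw [this]
    measurability
  refine measurable_pi_lambda _ fun j => ?_
  have : (fun x : Fin n → ℝ => orderStat x j) = fun x => ∑ σ : Equiv.Perm (Fin n),
      {x : Fin n → ℝ | Tuple.sort x = σ}.indicator (fun x => x (σ j)) x := by
    ext x
    rw [Finset.sum_eq_single (Tuple.sort x)]
    · simp [orderStat]
    · intro b _ hb
      simp [hb.symm]
    · simp
  rw [this]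
  exact Finset.measurable_sum _ fun σ _ => (measurable_pi_apply _).indicator (hset σ)

theorem orderStat_of_monotone {n : ℕ} {x : Fin n → ℝ} (hx : Monotone x) : orderStat x = x := by
  have := Tuple.unique_monotone (f := x) (σ := Tuple.sort x) (τ := 1) (Tuple.monotone_sort x)
    (by simpa using hx)
  simpa [orderStat] using this

theorem orderStat_comp_perm {n : ℕ} (x : Fin n → ℝ) (σ : Equiv.Perm (Fin n)) :
    orderStat (x ∘ σ) = orderStat x :=
  Tuple.comp_perm_comp_sort_eq_comp_sort

theorem ae_injective {n : ℕ} : ∀ᵐ x : Fin n → ℝ, Function.Injective x := by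
  have h : ∀ i j : Fin n, i ≠ j → ∀ᵐ x : Fin n → ℝ, x i ≠ x j := by
    intro i j hij
    let p : Submodule ℝ (Fin n → ℝ) :=
      LinearMap.ker ((LinearMap.proj i : (Fin n → ℝ) →ₗ[ℝ] ℝ) - LinearMap.proj j)
    have hp : p ≠ ⊤ := by
      intro hp
      have : (Pi.single i 1 : Fin n → ℝ) ∈ p := by rw [hp]; trivial
      simp [p, hij] at this
    have := Measure.addHaar_submodule (volume : Measure (Fin n → ℝ)) p hp
    rw [ae_iff]
    convert this using 2
    ext x
    simp [p, sub_eq_zero]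
  have h' : ∀ᵐ x : Fin n → ℝ, ∀ i j : Fin n, i ≠ j → x i ≠ x j := by
    simp only [ae_all_iff]
    exact h
  filter_upwards [h'] with x hx i j hij
  by_contra hne
  exact hx i j hne hij

/-- Integrals of symmetric functions reduce to the cone of monotone vectors. -/
theorem lintegral_symmetric {n : ℕ} (f : (Fin n → ℝ) → ℝ≥0∞) (hf : Measurable f)
    (hsymm : ∀ x (σ : Equiv.Perm (Fin n)), f (x ∘ σ) = f x) :
    ∫⁻ x, f x = n.factorial * ∫⁻ x, {x : Fin n → ℝ | Monotone x}.indicator f x := by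
  have hM : MeasurableSet {x : Fin n → ℝ | Monotone x} := by
    have : {x : Fin n → ℝ | Monotone x} = {x | ∀ i j, i ≤ j → x i ≤ x j} := rfl
    rw [this]
    measurability
  have hg : Measurable ({x : Fin n → ℝ | Monotone x}.indicator f) := hf.indicator hM
  have hperm : ∀ σ : Equiv.Perm (Fin n),
      MeasurePreserving (fun x : Fin n → ℝ => x ∘ σ) volume volume := fun σ =>
    volume_preserving_arrowCongr' σ.symm (MeasurableEquiv.refl ℝ) (MeasurePreserving.id _)
  -- Off the null set of ties exactly one permutation sorts x, so exactly one summand is nonzero.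
  have hae : f =ᵐ[volume] fun x => ∑ σ : Equiv.Perm (Fin n),
      {x : Fin n → ℝ | Monotone x}.indicator f (x ∘ σ) := by
    filter_upwards [ae_injective] with x hx
    rw [Finset.sum_eq_single (Tuple.sort x)]
    · rw [Set.indicator_of_mem (Tuple.monotone_sort x : Monotone (x ∘ Tuple.sort x)), hsymm]
    · intro σ _ hσ
      refine Set.indicator_of_notMem (fun hmon => hσ ?_) _
      have := Tuple.unique_monotone hmon (Tuple.monotone_sort x)
      ext i
      exact congrArg Fin.val (hx (congrFun this i))
    · simp
  rw [lintegral_congr_ae hae,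
    lintegral_finsetSum (μ := volume)
      (f := fun (σ : Equiv.Perm (Fin n)) x => {x : Fin n → ℝ | Monotone x}.indicator f (x ∘ σ))
      _ fun σ _ => hg.comp (hperm σ).measurable]
  have : ∀ σ : Equiv.Perm (Fin n), ∫⁻ x, {x : Fin n → ℝ | Monotone x}.indicator f (x ∘ σ) =
      ∫⁻ x, {x : Fin n → ℝ | Monotone x}.indicator f x := fun σ =>
    (hperm σ).lintegral_comp hg
  simp [this, Fintype.card_perm]

/-! ### Ordered vectors in terms of their increments. -/

/-- Partial sums of a vector. -/
noncomputable def partialSum {n : ℕ} (y : Fin n → ℝ) (i : Fin n) : ℝ := ∑ j ∈ Finset.Iic i, y j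

theorem partialSum_zero {n : ℕ} (y : Fin (n + 1) → ℝ) : partialSum y 0 = y 0 := by
  have : Finset.Iic (0 : Fin (n + 1)) = {0} := by ext i; simp
  simp [partialSum, this]

theorem partialSum_succ {n : ℕ} (y : Fin (n + 1) → ℝ) (i : Fin n) :
    partialSum y i.succ = partialSum y i.castSucc + y i.succ := by
  have : Finset.Iic i.succ = insert i.succ (Finset.Iic i.castSucc) := by
    ext l
    simp only [Finset.mem_Iic, Finset.mem_insert, Fin.le_def, Fin.ext_iff, Fin.val_succ,
      Fin.val_castSucc]
    omega
  rw [partialSum, this, Finset.sum_insert (by simp [Fin.le_def]), partialSum, add_comm]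

theorem partialSum_le_iff {n : ℕ} (y : Fin n → ℝ) :
    (0 ≤ partialSum y ∧ Monotone (partialSum y)) ↔ 0 ≤ y := by
  constructor
  · rintro ⟨h0, hmon⟩
    cases n with
    | zero => exact fun i => i.elim0
    | succ n =>
      intro i
      refine Fin.cases ?_ (fun i => ?_) i
      · simpa [partialSum_zero] using h0 0
      · have := hmon (Fin.castSucc_lt_succ (i := i)).le
        rw [partialSum_succ] at this
        simpa using this
  · intro hy
    refine ⟨fun i => Finset.sum_nonneg fun j _ => hy j, fun i j hij => ?_⟩
    exact Finset.sum_le_sum_of_subset_of_nonneg (Finset.Iic_subset_Iic.2 hij) fun l _ _ => hy l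

/-- The matrix is lower triangular with unit diagonal, so no Jacobian appears. -/
theorem measurePreserving_partialSum {n : ℕ} :
    MeasurePreserving (partialSum : (Fin n → ℝ) → Fin n → ℝ) volume volume := by
  classical
  let A : Matrix (Fin n) (Fin n) ℝ := Matrix.of fun i j => if j ≤ i then 1 else 0
  have hdet : A.det = 1 := by
    rw [Matrix.det_of_isLowerTriangular A]
    · simp [A]
    · intro i j hij
      have : i < j := hij
      simp [A, this]
  have hfun : (partialSum : (Fin n → ℝ) → Fin n → ℝ) = Matrix.toLin' A := by
    ext y i
    simp [partialSum, A, Matrix.mulVec, dotProduct, Finset.sum_ite]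
    exact Finset.sum_congr (by ext; simp) fun _ _ => rfl
  refine ⟨?_, ?_⟩
  · rw [hfun]
    exact (LinearMap.continuous_of_finiteDimensional _).measurable
  · rw [hfun, Real.map_matrix_volume_pi_eq_smul_volume_pi (by simp [hdet])]
    simp [hdet]

/-- A symmetric integral over the positive orthant in terms of the increments of the ordered
coordinates. -/
theorem setLIntegral_symmetric {n : ℕ} (f : (Fin n → ℝ) → ℝ≥0∞) (hf : Measurable f)
    (hsymm : ∀ x (σ : Equiv.Perm (Fin n)), f (x ∘ σ) = f x) :
    ∫⁻ x in Set.Ici 0, f x = n.factorial * ∫⁻ y in Set.Ici 0, f (partialSum y) := by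
  have hM : MeasurableSet {x : Fin n → ℝ | Monotone x} := by
    have : {x : Fin n → ℝ | Monotone x} = {x | ∀ i j, i ≤ j → x i ≤ x j} := rfl
    rw [this]
    measurability
  rw [← lintegral_indicator measurableSet_Ici, lintegral_symmetric _ (hf.indicator measurableSet_Ici),
    ← measurePreserving_partialSum.lintegral_comp ((hf.indicator measurableSet_Ici).indicator hM),
    ← lintegral_indicator measurableSet_Ici]
  · congr 1
    refine lintegral_congr fun y => ?_
    rw [Set.indicator_indicator]
    by_cases hy : 0 ≤ y
    · have := (partialSum_le_iff y).2 hy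
      have hmem : partialSum y ∈ {x : Fin n → ℝ | Monotone x} ∩ Set.Ici 0 := ⟨this.2, this.1⟩
      rw [Set.indicator_of_mem hmem, Set.indicator_of_mem (Set.mem_Ici.2 hy)]
    · rw [Set.indicator_of_notMem, Set.indicator_of_notMem (by simpa using hy)]
      exact fun h => hy ((partialSum_le_iff y).1 ⟨h.2, h.1⟩)
  · intro x σ
    have : x ∘ σ ∈ Set.Ici (0 : Fin n → ℝ) ↔ x ∈ Set.Ici 0 := by
      simp only [Set.mem_Ici, Pi.le_def, Pi.zero_apply, Function.comp_apply]
      exact σ.forall_congr_left.trans (by simp)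
    by_cases hx : x ∈ Set.Ici 0
    · rw [Set.indicator_of_mem hx, Set.indicator_of_mem (this.2 hx), hsymm]
    · rw [Set.indicator_of_notMem hx, Set.indicator_of_notMem (mt this.1 hx)]

/-! ### Truncated powers. -/

/-- The truncated power function, with the convention that its value at `0` is `0 ^ p`. -/
noncomputable def truncPow (p : ℕ) (x : ℝ) : ℝ := if 0 ≤ x then x ^ p else 0

theorem truncPow_nonneg (p : ℕ) (x : ℝ) : 0 ≤ truncPow p x := by
  unfold truncPow
  split_ifs with h
  · positivity
  · exact le_rfl

theorem truncPow_of_nonneg (p : ℕ) {x : ℝ} (h : 0 ≤ x) : truncPow p x = x ^ p := if_pos h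

theorem truncPow_of_neg (p : ℕ) {x : ℝ} (h : x < 0) : truncPow p x = 0 := if_neg h.not_ge

theorem truncPow_succ_eq (p : ℕ) (x : ℝ) : truncPow (p + 1) x = max x 0 ^ (p + 1) := by
  unfold truncPow
  split_ifs with h
  · rw [max_eq_left h]
  · rw [max_eq_right (not_le.1 h).le]
    simp

/-- The exponent must be positive to include x = 0, because `truncPow 0 0 = 1`. -/
theorem truncPow_of_nonpos (p : ℕ) {x : ℝ} (h : x ≤ 0) : truncPow (p + 1) x = 0 := by
  simp [truncPow_succ_eq, max_eq_right h]

@[fun_prop]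
theorem measurable_truncPow (p : ℕ) : Measurable (truncPow p) :=
  Measurable.ite measurableSet_Ici (by fun_prop) measurable_const

theorem monotone_truncPow (p : ℕ) : Monotone (truncPow p) := by
  intro x y hxy
  rcases lt_or_ge x 0 with hx | hx
  · rw [truncPow_of_neg p hx]
    exact truncPow_nonneg p y
  · rw [truncPow_of_nonneg p hx, truncPow_of_nonneg p (hx.trans hxy)]
    gcongr

theorem integral_truncPow (p : ℕ) (a b : ℝ) :
    ∫ x in a..b, truncPow p x = (truncPow (p + 1) b - truncPow (p + 1) a) / (p + 1) := by
  have hp : (p : ℝ) + 1 ≠ 0 := by positivity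
  -- For p = 0 the primitive has a corner at 0, where the integrand is its right derivative only.
  have h := intervalIntegral.integral_eq_sub_of_hasDeriv_right
    (f := fun x => truncPow (p + 1) x / (p + 1)) (f' := truncPow p) (a := a) (b := b) ?_ ?_
    (monotone_truncPow p).intervalIntegrable
  · rw [h]
    ring
  · simp only [truncPow_succ_eq]
    fun_prop
  · intro x _
    have hd : HasDerivAt (fun x : ℝ => x ^ (p + 1) / (p + 1)) (x ^ p) x := by
      have := (hasDerivAt_pow (p + 1) x).div_const ((p : ℝ) + 1)
      refine this.congr_deriv ?_
      push_cast
      field_simp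
    rcases lt_or_ge x 0 with hx | hx
    · rw [truncPow_of_neg p hx]
      refine HasDerivAt.hasDerivWithinAt ?_
      refine (hasDerivAt_const x (0 : ℝ)).congr_of_eventuallyEq ?_
      filter_upwards [Iio_mem_nhds hx] with y hy
      simp [truncPow_of_neg (p + 1) hy]
    · rw [truncPow_of_nonneg p hx]
      refine hd.hasDerivWithinAt.congr (fun y hy => ?_) ?_
      · rw [truncPow_of_nonneg _ (hx.trans (Set.mem_Ioi.1 hy).le)]
      · rw [truncPow_of_nonneg _ hx]

theorem integral_truncPow_affine (p : ℕ) (a v : ℝ) {b : ℝ} (hb : b ≠ 0) :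
    ∫ e in (0 : ℝ)..v, truncPow p (a + b * e) =
      (truncPow (p + 1) (a + b * v) - truncPow (p + 1) a) / ((p + 1) * b) := by
  have hp : (p : ℝ) + 1 ≠ 0 := by positivity
  rw [intervalIntegral.integral_comp_add_mul _ hb, integral_truncPow]
  simp only [mul_zero, add_zero, smul_eq_mul]
  field_simp

theorem intervalIntegrable_truncPow_affine (p : ℕ) (a b u v : ℝ) :
    IntervalIntegrable (fun e => truncPow p (a + b * e)) volume u v := by
  rcases le_total 0 b with hb | hb
  · refine Monotone.intervalIntegrable fun x y hxy => monotone_truncPow p ?_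
    nlinarith [mul_le_mul_of_nonneg_left hxy hb]
  · refine Antitone.intervalIntegrable fun x y hxy => monotone_truncPow p ?_
    nlinarith [mul_le_mul_of_nonpos_left hxy hb]

/-! ### The joint density of the two linear forms and its recursion. -/

/-- Coefficient of the `i`-th truncated power in `rangeSumDensity`. -/
noncomputable def densityCoeff (k j i : ℕ) : ℝ :=
  (-1) ^ (j - i) * ((i : ℝ) + 1) ^ j / (((i : ℝ) + 1) * (k : ℝ) ^ j * i.factorial *
    (j - i).factorial * k.factorial * (k - 1 + j).factorial)

/-- Joint density of `∑ i, min k (n - i) * y i` and `∑ i, (n - i - k)⁺ * y i` under Lebesgue measure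
on the positive orthant of dimension `n = k + j + 1`, for nonnegative values of the second sum. -/
noncomputable def rangeSumDensity (k j : ℕ) (s v : ℝ) : ℝ :=
  ∑ i ∈ Finset.range (j + 1), densityCoeff k j i * truncPow (k - 1 + j) (s - k * v / (i + 1))

/-- Up to a constant this is the (j + 1)-st forward difference at 1 of the polynomial x ^ j. It
expresses the last coefficient as minus the sum of the others. -/
theorem sum_densityCoeff (k j : ℕ) :
    ∑ i ∈ Finset.range (j + 2), densityCoeff k (j + 1) i = 0 := by
  have h := congrFun (fwdDiff_iter_pow_eq_zero_of_lt (R := ℝ) (Nat.lt_succ_self j)) 1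
  rw [fwdDiff_iter_eq_sum_shift] at h
  have hi : ∀ i ∈ Finset.range (j + 2), densityCoeff k (j + 1) i =
      1 / ((k : ℝ) ^ (j + 1) * k.factorial * (k - 1 + (j + 1)).factorial * (j + 1).factorial) *
      (((-1 : ℤ) ^ (j.succ - i) * (j.succ.choose i : ℤ)) • ((1 : ℝ) + i • (1 : ℝ)) ^ j) := by
    intro i hi
    have hij : i ≤ j + 1 := by simpa [Nat.lt_succ_iff] using hi
    have hc : ((j + 1).choose i : ℝ) = (j + 1).factorial / (i.factorial * (j + 1 - i).factorial) :=
      Nat.cast_choose ℝ hij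
    simp only [Nat.succ_eq_add_one, zsmul_eq_mul, nsmul_eq_mul, mul_one]
    push_cast
    rw [hc, densityCoeff, pow_succ ((i : ℝ) + 1), add_comm (1 : ℝ)]
    have h1 : (i : ℝ) + 1 ≠ 0 := by positivity
    -- For k = 0 both sides are quotients by zero, hence 0.
    rcases eq_or_ne (k : ℝ) 0 with hk | hk
    · simp [hk]
    field_simp
  rw [Finset.sum_congr rfl hi, ← Finset.mul_sum, h]
  simp

/-- The divisor is the one produced by integrating the i-th truncated power along the ray: the new
exponent times the slope of its argument. -/
theorem densityCoeff_succ {k j i : ℕ} (hk : 1 ≤ k) (hij : i ≤ j) :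
    densityCoeff k j i / (((k - 1 + j : ℕ) + 1) * (k * (1 / ((i : ℝ) + 1) - 1 / (j + 2)))) =
      -((j + 2) * densityCoeff k (j + 1) i) := by
  obtain ⟨d, rfl⟩ := Nat.exists_eq_add_of_le hij
  obtain ⟨k, rfl⟩ := Nat.exists_eq_add_of_le' hk
  have h1 : i + d + 1 - i = d + 1 := by omega
  have h2 : i + d - i = d := by omega
  have h3 : k + 1 - 1 + (i + d + 1) = (k + 1 - 1 + (i + d)) + 1 := by omega
  have h4 : 1 / ((i : ℝ) + 1) - 1 / ((i + d : ℕ) + 2) =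
      (d + 1) / (((i : ℝ) + 1) * ((i + d : ℕ) + 2)) := by
    push_cast
    field_simp
    ring
  rw [h4]
  unfold densityCoeff
  rw [h1, h2, h3, Nat.factorial_succ d, Nat.factorial_succ (k + 1 - 1 + (i + d))]
  generalize k + 1 - 1 + (i + d) = p
  push_cast
  have : (k : ℝ) + 1 ≠ 0 := by positivity
  have : (i : ℝ) + 1 ≠ 0 := by positivity
  have : (d : ℝ) + 1 ≠ 0 := by positivity
  have : (p : ℝ) + 1 ≠ 0 := by positivity
  have : (i : ℝ) + d + 2 ≠ 0 := by positivity
  field_simp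
  ring

theorem rangeSumDensity_zero {k : ℕ} (s v : ℝ) : rangeSumDensity k 0 s v =
    1 / (k.factorial * (k - 1).factorial) * truncPow (k - 1) (s - k * v) := by
  simp [rangeSumDensity, densityCoeff]

@[fun_prop]
theorem measurable_rangeSumDensity (k j : ℕ) :
    Measurable fun p : ℝ × ℝ => rangeSumDensity k j p.1 p.2 := by
  unfold rangeSumDensity
  fun_prop

theorem intervalIntegrable_rangeSumDensity (k j : ℕ) (s v c a b : ℝ) :
    IntervalIntegrable (fun e => rangeSumDensity k j (s - c * e) (v - e)) volume a b := by
  unfold rangeSumDensity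
  have := IntervalIntegrable.sum (μ := volume) (a := a) (b := b) (Finset.range (j + 1))
    (f := fun i e => densityCoeff k j i * truncPow (k - 1 + j) (s - c * e - k * (v - e) / (i + 1)))
    fun i _ => IntervalIntegrable.const_mul ?_ _
  · simpa only [Finset.sum_fn] using this
  convert intervalIntegrable_truncPow_affine (k - 1 + j) (s - k * v / (i + 1)) (k / (i + 1) - c) a b
    using 3
  ring

/-- The argument of the i-th truncated power is affine in e. At e = 0 it gives the i-th power of the
new density; at e = v it is s - k v / (j + 2) whatever i is. The latter terms therefore merge into
one, whose coefficient `sum_densityCoeff` identifies as the (j + 1)-st. -/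
theorem integral_rangeSumDensity {k : ℕ} (hk : 1 ≤ k) (j : ℕ) (s v : ℝ) :
    ∫ e in (0 : ℝ)..v, rangeSumDensity k j (s - k / (j + 2) * e) (v - e) =
      (j + 2) * rangeSumDensity k (j + 1) s v := by
  have hk0 : (k : ℝ) ≠ 0 := by positivity
  have hlin : ∀ (i : ℕ) (e : ℝ), s - k / (j + 2) * e - k * (v - e) / (i + 1) =
      (s - k * v / (i + 1)) + k * (1 / ((i : ℝ) + 1) - 1 / (j + 2)) * e := by
    intro i e
    ring
  unfold rangeSumDensity
  simp only [hlin]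
  rw [intervalIntegral.integral_finsetSum fun i _ =>
    (intervalIntegrable_truncPow_affine _ _ _ _ _).const_mul _]
  have hterm : ∀ i ∈ Finset.range (j + 1),
      ∫ e in (0 : ℝ)..v, densityCoeff k j i * truncPow (k - 1 + j)
        ((s - k * v / (i + 1)) + k * (1 / ((i : ℝ) + 1) - 1 / (j + 2)) * e) =
      (j + 2) * (densityCoeff k (j + 1) i * (truncPow (k - 1 + (j + 1)) (s - k * v / (i + 1)))) -
      (j + 2) * truncPow (k - 1 + (j + 1)) (s - k * v / (j + 2)) * densityCoeff k (j + 1) i := by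
    intro i hi
    have hij : i ≤ j := by simpa [Nat.lt_succ_iff] using hi
    have hne : (k : ℝ) * (1 / ((i : ℝ) + 1) - 1 / (j + 2)) ≠ 0 := by
      refine mul_ne_zero hk0 (sub_ne_zero.2 fun h => ?_)
      have : (i : ℝ) + 1 = j + 2 := by simpa using h
      have : (i : ℝ) ≤ j := by exact_mod_cast hij
      linarith
    rw [intervalIntegral.integral_const_mul, integral_truncPow_affine _ _ _ hne, mul_div_assoc',
      mul_div_right_comm, densityCoeff_succ hk hij]
    have : s - k * v / (i + 1) + k * (1 / ((i : ℝ) + 1) - 1 / (j + 2)) * v =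
      s - k * v / (j + 2) := by ring
    rw [this, add_assoc]
    ring
  rw [Finset.sum_congr rfl hterm, Finset.sum_sub_distrib, ← Finset.mul_sum, ← Finset.mul_sum,
    Finset.sum_range_succ _ (j + 1)]
  have h0 := sum_densityCoeff k j
  rw [Finset.sum_range_succ] at h0
  have h1 : ((j + 1 : ℕ) : ℝ) + 1 = j + 2 := by push_cast; ring
  rw [eq_neg_of_add_eq_zero_left h0, h1]
  ring

/-- The signs in the sum alternate, so nonnegativity is drawn from the integral recursion instead.
-/
theorem rangeSumDensity_nonneg {k : ℕ} (hk : 1 ≤ k) (j : ℕ) (s : ℝ) {v : ℝ} (hv : 0 ≤ v) :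
    0 ≤ rangeSumDensity k j s v := by
  induction j generalizing s v with
  | zero =>
    rw [rangeSumDensity_zero]
    exact mul_nonneg (by positivity) (truncPow_nonneg _ _)
  | succ j ih =>
    have h := integral_rangeSumDensity hk j s v
    have h2 : 0 ≤ ∫ e in (0 : ℝ)..v, rangeSumDensity k j (s - k / (j + 2) * e) (v - e) :=
      intervalIntegral.integral_nonneg hv fun e he => ih _ (by linarith [he.2])
    rw [h] at h2
    exact nonneg_of_mul_nonneg_right h2 (by positivity)

/-! ### Integrals over half-lines and convolution along rays. -/

theorem setLIntegral_Ici_indicator_Iic {f : ℝ → ℝ} {v : ℝ} (hv : 0 ≤ v)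
    (hf : IntervalIntegrable f volume 0 v) (hnn : ∀ a ∈ Set.Icc 0 v, 0 ≤ f a) :
    ∫⁻ a in Set.Ici (0 : ℝ), (Set.Iic v).indicator (fun a => ENNReal.ofReal (f a)) a =
      ENNReal.ofReal (∫ a in (0 : ℝ)..v, f a) := by
  rw [setLIntegral_indicator measurableSet_Iic, Set.inter_comm, Set.Ici_inter_Iic,
    setLIntegral_congr Ioc_ae_eq_Icc.symm, intervalIntegral.integral_of_le hv,
    ofReal_integral_eq_lintegral_ofReal]
  · exact (intervalIntegrable_iff_integrableOn_Ioc_of_le hv).1 hf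
  · exact (ae_restrict_iff' measurableSet_Ioc).2 (ae_of_all _ fun a ha => hnn a ⟨ha.1.le, ha.2⟩)

theorem lintegral_truncPow_sub_mul (p : ℕ) {c : ℝ} (hc : 0 < c) (w : ℝ) :
    ∫⁻ a in Set.Ici (0 : ℝ), ENNReal.ofReal (truncPow p (w - c * a)) =
      ENNReal.ofReal (truncPow (p + 1) w / ((p + 1) * c)) := by
  have hrw : ∀ a : ℝ, w - c * a = w + -c * a := fun a => by ring
  rcases lt_or_ge w 0 with hw | hw
  · rw [truncPow_of_neg _ hw, setLIntegral_congr_fun (g := fun _ => 0) measurableSet_Ici]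
    · simp
    · intro a ha
      have : 0 ≤ c * a := mul_nonneg hc.le ha
      simp [truncPow_of_neg p (show w - c * a < 0 by linarith)]
  · have hind : ∀ a : ℝ, ENNReal.ofReal (truncPow p (w - c * a)) =
        (Set.Iic (w / c)).indicator (fun a => ENNReal.ofReal (truncPow p (w + -c * a))) a := by
      intro a
      by_cases ha : a ≤ w / c
      · rw [Set.indicator_of_mem (Set.mem_Iic.2 ha), hrw]
      · rw [Set.indicator_of_notMem (by simpa using ha), truncPow_of_neg, ENNReal.ofReal_zero]
        have := (div_lt_iff₀ hc).1 (not_le.1 ha)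
        linarith
    simp only [hind]
    rw [setLIntegral_Ici_indicator_Iic (by positivity)
      (intervalIntegrable_truncPow_affine _ _ _ _ _) fun a _ => truncPow_nonneg _ _,
      integral_truncPow_affine _ _ _ (neg_ne_zero.2 hc.ne')]
    have h0 : w + -c * (w / c) = 0 := by field_simp; ring
    rw [h0, truncPow_of_nonpos _ le_rfl]
    congr 1
    field_simp
    ring

/-- Convolution with a ray direction, for densities on the line. -/
theorem lintegral_ray_add (c : ℝ) (φ g : ℝ → ℝ≥0∞) (hφ : Measurable φ) (hg : Measurable g) :
    ∫⁻ a in Set.Ici (0 : ℝ), ∫⁻ w, φ (c * a + w) * g w =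
      ∫⁻ w, φ w * ∫⁻ a in Set.Ici (0 : ℝ), g (w - c * a) := by
  have h1 : ∀ a : ℝ, ∫⁻ w, φ (c * a + w) * g w = ∫⁻ w, φ w * g (w - c * a) := by
    intro a
    rw [← lintegral_sub_right_eq_self (fun w => φ (c * a + w) * g w) (c * a)]
    simp
  simp only [h1]
  rw [lintegral_lintegral_swap (by fun_prop)]
  refine lintegral_congr fun w => ?_
  rw [lintegral_const_mul _ (by fun_prop)]

/-- Convolution with a ray direction, for densities on the plane. -/
theorem lintegral_ray_add_prod (c d : ℝ) (φ g : ℝ × ℝ → ℝ≥0∞) (hφ : Measurable φ)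
    (hg : Measurable g) :
    ∫⁻ a in Set.Ici (0 : ℝ), ∫⁻ p, φ (c * a + p.1, d * a + p.2) * g p =
      ∫⁻ p, φ p * ∫⁻ a in Set.Ici (0 : ℝ), g (p.1 - c * a, p.2 - d * a) := by
  have h1 : ∀ a : ℝ, ∫⁻ p, φ (c * a + p.1, d * a + p.2) * g p =
      ∫⁻ p : ℝ × ℝ, φ p * g (p.1 - c * a, p.2 - d * a) := by
    intro a
    rw [← lintegral_sub_right_eq_self (fun p : ℝ × ℝ => φ (c * a + p.1, d * a + p.2) * g p)
      (c * a, d * a)]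
    simp [Prod.sub_def]
  simp only [h1]
  rw [lintegral_lintegral_swap (by fun_prop)]
  refine lintegral_congr fun w => ?_
  rw [lintegral_const_mul _ (by fun_prop)]

/-! ### The law of the two linear forms on the orthant. -/

/-- The linear form `∑ i, min k (n - i) * y i`, which is the sum of the `k` largest partial sums. -/
noncomputable def topForm (k n : ℕ) (y : Fin n → ℝ) : ℝ :=
  ∑ i : Fin n, ((min k (n - i) : ℕ) : ℝ) * y i

/-- The linear form `∑ i, (n - i - k)⁺ * y i`, which is the sum of the remaining partial sums. -/
noncomputable def bottomForm (k n : ℕ) (y : Fin n → ℝ) : ℝ :=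
  ∑ i : Fin n, ((n - i - k : ℕ) : ℝ) * y i

@[fun_prop]
theorem measurable_topForm (k n : ℕ) : Measurable (topForm k n) := by
  unfold topForm
  fun_prop

@[fun_prop]
theorem measurable_bottomForm (k n : ℕ) : Measurable (bottomForm k n) := by
  unfold bottomForm
  fun_prop

theorem topForm_cons (k n : ℕ) (a : ℝ) (y : Fin n → ℝ) :
    topForm k (n + 1) (Fin.cons a y) = (min k (n + 1) : ℕ) * a + topForm k n y := by
  simp [topForm, Fin.sum_univ_succ]

theorem bottomForm_cons (k n : ℕ) (a : ℝ) (y : Fin n → ℝ) :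
    bottomForm k (n + 1) (Fin.cons a y) = (n + 1 - k : ℕ) * a + bottomForm k n y := by
  simp [bottomForm, Fin.sum_univ_succ]

@[fun_prop]
theorem measurable_finCons {n : ℕ} :
    Measurable fun p : ℝ × (Fin n → ℝ) => (Fin.cons p.1 p.2 : Fin (n + 1) → ℝ) := by
  refine measurable_pi_lambda _ fun i => ?_
  refine Fin.cases ?_ (fun i => ?_) i
  · simpa using measurable_fst
  · simp only [Fin.cons_succ]
    fun_prop

theorem bottomForm_eq_zero {k n : ℕ} (h : n ≤ k) (y : Fin n → ℝ) : bottomForm k n y = 0 := by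
  refine Finset.sum_eq_zero fun i _ => ?_
  have : n - i - k = 0 := by omega
  simp [this]

/-- The weights are n + 1, …, 1. Their product gives (n + 1)!, and the repeated integration of the
truncated power gives n!. -/
theorem setLIntegral_topForm_of_le {k n : ℕ} (h : n + 1 ≤ k) (φ : ℝ → ℝ≥0∞) (hφ : Measurable φ) :
    ∫⁻ y in Set.Ici (0 : Fin (n + 1) → ℝ), φ (topForm k (n + 1) y) =
      ∫⁻ w, φ w * ENNReal.ofReal (1 / ((n + 1).factorial * n.factorial) * truncPow n w) := by
  induction n generalizing φ with
  | zero =>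
    rw [setLIntegral_Ici_cons _ (by fun_prop), ← lintegral_indicator measurableSet_Ici]
    refine lintegral_congr fun w => ?_
    have h0 : ∀ y : Fin 0 → ℝ, y ∈ Set.Ici (0 : Fin 0 → ℝ) := fun y i => i.elim0
    have h1 : Set.Ici (0 : Fin 0 → ℝ) = Set.univ := Set.eq_univ_of_forall h0
    have h2 : (volume : Measure (Fin 0 → ℝ)) Set.univ = 1 := by
      rw [Measure.volume_pi_eq_dirac (0 : Fin 0 → ℝ)]
      simp
    rw [h1]
    by_cases hw : 0 ≤ w
    · simp [topForm, truncPow, hw, h, h2]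
    · simp [truncPow, hw]
  | succ n ih =>
    rw [setLIntegral_Ici_cons _ (by fun_prop)]
    simp only [topForm_cons, min_eq_right h]
    have hpos : (0 : ℝ) < (n + 1 + 1 : ℕ) := by positivity
    rw [lintegral_congr fun a => ih (by omega) (fun w => φ (((n + 1 + 1 : ℕ) : ℝ) * a + w))
      (by fun_prop), lintegral_ray_add _ _ _ hφ (by fun_prop)]
    refine lintegral_congr fun w => ?_
    congr 1
    simp only [ENNReal.ofReal_mul (show (0 : ℝ) ≤ 1 / ((n + 1).factorial * n.factorial) by positivity)]
    rw [lintegral_const_mul _ (by fun_prop), lintegral_truncPow_sub_mul _ hpos,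
      ← ENNReal.ofReal_mul (by positivity)]
    congr 1
    rw [Nat.factorial_succ (n + 1), Nat.factorial_succ n]
    push_cast
    field_simp

/-- This is `integral_rangeSumDensity` under e = (j + 2) a; the Jacobian cancels its factor j + 2.
-/
theorem lintegral_rangeSumDensity {k : ℕ} (hk : 1 ≤ k) (j : ℕ) (s v : ℝ) :
    ∫⁻ a in Set.Ici (0 : ℝ), (Set.Ici (0 : ℝ)).indicator
        (fun v' => ENNReal.ofReal (rangeSumDensity k j (s - k * a) v')) (v - (j + 2) * a) =
      (Set.Ici (0 : ℝ)).indicator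
        (fun v => ENNReal.ofReal (rangeSumDensity k (j + 1) s v)) v := by
  have hj : (0 : ℝ) < j + 2 := by positivity
  rcases lt_or_ge v 0 with hv | hv
  · rw [Set.indicator_of_notMem (by simpa using hv),
      setLIntegral_congr_fun (g := fun _ => 0) measurableSet_Ici]
    · simp
    · intro a ha
      have : 0 ≤ (j + 2) * a := mul_nonneg hj.le ha
      exact Set.indicator_of_notMem (by simp only [Set.mem_Ici, not_le]; linarith) _
  · rw [Set.indicator_of_mem (Set.mem_Ici.2 hv)]
    let F : ℝ → ℝ := fun e => rangeSumDensity k j (s - k / (j + 2) * e) (v - e)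
    have hF : ∀ a, F ((j + 2) * a) = rangeSumDensity k j (s - k * a) (v - (j + 2) * a) := by
      intro a
      simp only [F]
      congr 1
      field_simp
    have hind : ∀ a : ℝ, (Set.Ici (0 : ℝ)).indicator
        (fun v' => ENNReal.ofReal (rangeSumDensity k j (s - k * a) v')) (v - (j + 2) * a) =
        (Set.Iic (v / (j + 2))).indicator (fun a => ENNReal.ofReal (F ((j + 2) * a))) a := by
      intro a
      have hiff : 0 ≤ v - (j + 2) * a ↔ a ≤ v / (j + 2) := by
        rw [sub_nonneg, le_div_iff₀ hj, mul_comm]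
      by_cases ha : a ≤ v / (j + 2)
      · rw [Set.indicator_of_mem (Set.mem_Iic.2 ha), hF,
          Set.indicator_of_mem (Set.mem_Ici.2 (hiff.2 ha))]
      · rw [Set.indicator_of_notMem (mt Set.mem_Iic.1 ha),
          Set.indicator_of_notMem (fun h => ha (hiff.1 (Set.mem_Ici.1 h)))]
    simp only [hind]
    rw [setLIntegral_Ici_indicator_Iic (by positivity)]
    · rw [intervalIntegral.integral_comp_mul_left _ hj.ne', mul_zero, mul_div_cancel₀ _ hj.ne',
        integral_rangeSumDensity hk, smul_eq_mul, inv_mul_cancel_left₀ hj.ne']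
    · have := (intervalIntegrable_rangeSumDensity k j s v (k / (j + 2)) 0 v).comp_mul_left
        (c := (j : ℝ) + 2)
      simpa using this
    · intro a ha
      rw [hF]
      refine rangeSumDensity_nonneg hk _ _ ?_
      have := (le_div_iff₀ hj).1 ha.2
      linarith

theorem measurable_indicator_rangeSumDensity (k j : ℕ) :
    Measurable fun p : ℝ × ℝ => (Set.Ici (0 : ℝ)).indicator
      (fun v => ENNReal.ofReal (rangeSumDensity k j p.1 v)) p.2 := by
  have : (fun p : ℝ × ℝ => (Set.Ici (0 : ℝ)).indicator
      (fun v => ENNReal.ofReal (rangeSumDensity k j p.1 v)) p.2) =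
      (Prod.snd ⁻¹' Set.Ici (0 : ℝ)).indicator
        fun p : ℝ × ℝ => ENNReal.ofReal (rangeSumDensity k j p.1 p.2) := rfl
  rw [this]
  exact (by fun_prop : Measurable fun p : ℝ × ℝ => ENNReal.ofReal (rangeSumDensity k j p.1 p.2)
    ).indicator (measurable_snd measurableSet_Ici)

/-- Induction by splitting off the first coordinate. For j = 0 it has weights (k, 1) and alone
enters the second form, so v is that coordinate; the other k coordinates fall under
`setLIntegral_topForm_of_le`. In the inductive step its weights are (k, j + 2). -/
theorem setLIntegral_topForm_bottomForm {k : ℕ} (hk : 1 ≤ k) (j : ℕ) (φ : ℝ × ℝ → ℝ≥0∞)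
    (hφ : Measurable φ) :
    ∫⁻ y in Set.Ici (0 : Fin (k + j + 1) → ℝ),
        φ (topForm k (k + j + 1) y, bottomForm k (k + j + 1) y) =
      ∫⁻ p : ℝ × ℝ, φ p * (Set.Ici (0 : ℝ)).indicator
        (fun v => ENNReal.ofReal (rangeSumDensity k j p.1 v)) p.2 := by
  induction j generalizing φ with
  | zero =>
    obtain ⟨n, rfl⟩ := Nat.exists_eq_add_of_le' hk
    have h1 : n + 1 + 0 + 1 - (n + 1) = 1 := by omega
    have h2 : min (n + 1) (n + 1 + 0 + 1) = n + 1 := by omega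
    rw [setLIntegral_Ici_cons _ (by fun_prop)]
    simp only [topForm_cons, bottomForm_cons, h1, h2]
    have hbase : ∀ a : ℝ, ∫⁻ y in Set.Ici (0 : Fin (n + 1 + 0) → ℝ),
        φ (((n + 1 : ℕ) : ℝ) * a + topForm (n + 1) (n + 1 + 0) y,
          ((1 : ℕ) : ℝ) * a + bottomForm (n + 1) (n + 1 + 0) y) =
        ∫⁻ s, φ (s, a) * ENNReal.ofReal (rangeSumDensity (n + 1) 0 s a) := by
      intro a
      simp only [bottomForm_eq_zero (show n + 1 + 0 ≤ n + 1 by omega)]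
      rw [setLIntegral_topForm_of_le le_rfl
        (fun w => φ (((n + 1 : ℕ) : ℝ) * a + w, ((1 : ℕ) : ℝ) * a + 0)) (by fun_prop),
        ← lintegral_sub_right_eq_self _ (((n + 1 : ℕ) : ℝ) * a)]
      simp [rangeSumDensity_zero]
    rw [lintegral_congr hbase, Measure.volume_eq_prod, lintegral_prod_symm,
      ← lintegral_indicator measurableSet_Ici]
    · refine lintegral_congr fun a => ?_
      by_cases ha : 0 ≤ a
      · simp [ha]
      · simp [ha]
    · exact (hφ.mul (measurable_indicator_rangeSumDensity _ _)).aemeasurable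
  | succ j ih =>
    have h1 : k + j + 1 + 1 - k = j + 2 := by omega
    have h2 : min k (k + j + 1 + 1) = k := by omega
    change ∫⁻ y in Set.Ici (0 : Fin (k + j + 1 + 1) → ℝ),
        φ (topForm k (k + j + 1 + 1) y, bottomForm k (k + j + 1 + 1) y) = _
    rw [setLIntegral_Ici_cons _ (by fun_prop)]
    simp only [topForm_cons, bottomForm_cons, h1, h2]
    rw [lintegral_congr fun a => ih (fun p => φ ((k : ℝ) * a + p.1, ((j + 2 : ℕ) : ℝ) * a + p.2))
      (by fun_prop),
      lintegral_ray_add_prod _ _ _ _ hφ (measurable_indicator_rangeSumDensity k j)]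
    refine lintegral_congr fun p => ?_
    rw [← lintegral_rangeSumDensity hk]
    simp

/-! ### From the sample to the spacings, and from the spacings to the linear forms. -/

@[fun_prop]
theorem measurable_sumLargest (k m : ℕ) :
    Measurable (sumLargest k : (Fin m → ℝ) → ℝ) := by
  unfold sumLargest
  exact Finset.measurable_sum _ fun j _ => (measurable_pi_apply j).comp measurable_orderStat

@[fun_prop]
theorem measurable_innerSpacing (n : ℕ) :
    Measurable (innerSpacing : (Fin n → ℝ) → Fin (n - 1) → ℝ) := by
  unfold innerSpacing
  exact measurable_pi_lambda _ fun j => ((measurable_pi_apply _).comp measurable_orderStat).sub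
    ((measurable_pi_apply _).comp measurable_orderStat)

@[fun_prop]
theorem measurable_partialSum (n : ℕ) :
    Measurable (partialSum : (Fin n → ℝ) → Fin n → ℝ) :=
  measurePreserving_partialSum.measurable

theorem sumLargest_comp_perm {m : ℕ} (k : ℕ) (g : Fin m → ℝ) (σ : Equiv.Perm (Fin m)) :
    sumLargest k (g ∘ σ) = sumLargest k g := by
  simp only [sumLargest, orderStat_comp_perm]

theorem innerSpacing_comp_perm {n : ℕ} (x : Fin n → ℝ) (σ : Equiv.Perm (Fin n)) :
    innerSpacing (x ∘ σ) = innerSpacing x := by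
  ext j
  simp only [innerSpacing, orderStat_comp_perm]

theorem innerSpacing_partialSum {n : ℕ} {y : Fin (n + 1) → ℝ} (hy : 0 ≤ y) :
    innerSpacing (partialSum y) = fun j : Fin n => y j.succ := by
  ext j
  simp only [innerSpacing, orderStat_of_monotone ((partialSum_le_iff y).2 hy).2]
  have := partialSum_succ y j
  exact sub_eq_of_eq_add' this

theorem partialSum_le_const_iff {n : ℕ} {y : Fin (n + 1) → ℝ} (hy : 0 ≤ y) (c : ℝ) :
    (∀ i, partialSum y i ≤ c) ↔ ∑ i, y i ≤ c := by
  have hlast : partialSum y (Fin.last n) = ∑ i, y i :=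
    Finset.sum_congr (by ext i; simp [Fin.le_last]) fun _ _ => rfl
  rw [← hlast]
  exact ⟨fun h => h _, fun h i => (((partialSum_le_iff y).2 hy).2 (Fin.le_last i)).trans h⟩

theorem sum_filter_partialSum {n : ℕ} (p : Fin n → Prop) [DecidablePred p] (y : Fin n → ℝ) :
    ∑ j with p j, partialSum y j = ∑ i, ((Finset.univ.filter fun j => i ≤ j ∧ p j).card : ℝ) * y i := by
  simp only [partialSum]
  rw [Finset.sum_comm' (t' := Finset.univ) (s' := fun i => Finset.univ.filter fun j => i ≤ j ∧ p j)]
  · simp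
  · intro j i
    simp [and_comm]

/-- Partial sums of a nonnegative vector are already sorted, and `y i` occurs in min k (n - i) of
the last k of them. -/
theorem sumLargest_partialSum {n k : ℕ} (hk : 1 ≤ k) (hkn : k ≤ n) {y : Fin n → ℝ} (hy : 0 ≤ y) :
    sumLargest k (partialSum y) = topForm k n y := by
  rw [sumLargest, orderStat_of_monotone ((partialSum_le_iff y).2 hy).2, sum_filter_partialSum]
  refine Finset.sum_congr rfl fun i _ => ?_
  have hlt : max (i : ℕ) (n - k) < n := by have := i.2; omega
  have : (Finset.univ.filter fun j : Fin n => i ≤ j ∧ n ≤ j.val + k) =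
      Finset.Ici (⟨max i (n - k), hlt⟩ : Fin n) := by
    ext j
    simp only [Finset.mem_filter, Finset.mem_univ, true_and, Finset.mem_Ici, Fin.le_def]
    omega
  rw [this, Fin.card_Ici]
  congr 2
  simp only
  omega

theorem sum_partialSum {n : ℕ} (k : ℕ) (y : Fin n → ℝ) :
    ∑ i, partialSum y i = topForm k n y + bottomForm k n y := by
  have h := sum_filter_partialSum (fun _ => True) y
  simp only [Finset.filter_true] at h
  rw [h, topForm, bottomForm, ← Finset.sum_add_distrib]
  refine Finset.sum_congr rfl fun i _ => ?_
  have hc : (Finset.univ.filter fun j : Fin n => i ≤ j ∧ True) = Finset.Ici i := by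
    ext j
    simp
  rw [hc, Fin.card_Ici, ← add_mul, ← Nat.cast_add]
  congr 2
  omega

/-- The marginal density of the sum of the `k` largest among `k + j + 1` inner spacings, up to
normalization. -/
noncomputable def marginalDensity (k j : ℕ) (s : ℝ) : ℝ :=
  ∫ v in (0 : ℝ)..(1 - s), (1 - s - v) * rangeSumDensity k j s v

/-- `ENNReal.ofReal` truncates the weight at v = 1 - s, so nothing is left for s > 1; for s < 0 all
the truncated powers vanish. -/
theorem lintegral_range_marginal {k : ℕ} (hk : 1 ≤ k) (j : ℕ) (s : ℝ) :
    ∫⁻ v, ENNReal.ofReal (1 - (s + v)) * (Set.Ici (0 : ℝ)).indicator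
        (fun v => ENNReal.ofReal (rangeSumDensity k j s v)) v =
      ENNReal.ofReal ((Set.Icc (0 : ℝ) 1).indicator (marginalDensity k j) s) := by
  have h0 : ∀ v, ENNReal.ofReal (1 - (s + v)) * (Set.Ici (0 : ℝ)).indicator
      (fun v => ENNReal.ofReal (rangeSumDensity k j s v)) v = (Set.Ici (0 : ℝ)).indicator
      (fun v => ENNReal.ofReal (1 - (s + v)) * ENNReal.ofReal (rangeSumDensity k j s v)) v := by
    intro v
    rw [Set.indicator_mul_right]
  simp only [h0]
  rw [lintegral_indicator measurableSet_Ici]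
  by_cases hs : s ∈ Set.Icc (0 : ℝ) 1
  · rw [Set.indicator_of_mem hs, marginalDensity, ← setLIntegral_Ici_indicator_Iic]
    · refine setLIntegral_congr_fun measurableSet_Ici fun v hv => ?_
      by_cases hv1 : v ≤ 1 - s
      · rw [Set.indicator_of_mem (Set.mem_Iic.2 hv1), ENNReal.ofReal_mul (by linarith), sub_sub]
      · rw [Set.indicator_of_notMem (by simpa using hv1),
          ENNReal.ofReal_of_nonpos (by linarith : 1 - (s + v) ≤ 0), zero_mul]
    · linarith [hs.2]
    · have := intervalIntegrable_rangeSumDensity k j s 0 0 0 (-(1 - s))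
      have := this.comp_mul_left (c := -1)
      simp only [zero_mul, sub_zero, zero_sub, neg_mul, one_mul, neg_neg, div_neg, div_one] at this
      simpa using this.continuousOn_mul (g := fun v => 1 - s - v) (by fun_prop)
    · intro v hv
      exact mul_nonneg (by linarith [hv.2]) (rangeSumDensity_nonneg hk j s hv.1)
  · rw [Set.indicator_of_notMem hs, ENNReal.ofReal_zero,
      setLIntegral_congr_fun (g := fun _ => 0) measurableSet_Ici]
    · simp
    · intro v hv
      have hv : 0 ≤ v := hv
      rcases lt_or_ge s 0 with hs0 | hs0
      · have : rangeSumDensity k j s v = 0 := by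
          refine Finset.sum_eq_zero fun i _ => ?_
          have : 0 ≤ k * v / (i + 1) := by positivity
          rw [truncPow_of_neg _ (by linarith), mul_zero]
        simp [this]
      · have hs1 : 1 < s := not_le.1 fun h => hs ⟨hs0, h⟩
        simp [ENNReal.ofReal_of_nonpos (by linarith : 1 - (s + v) ≤ 0)]

/-- The second sorting, applied to the spacings themselves. -/
theorem setLIntegral_sumLargest_simplex {k : ℕ} (hk : 1 ≤ k) (j : ℕ) (φ : ℝ → ℝ≥0∞)
    (hφ : Measurable φ) :
    ∫⁻ g in Set.Ici (0 : Fin (k + j + 1) → ℝ),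
        φ (sumLargest k g) * ENNReal.ofReal (1 - ∑ i, g i) =
      (k + j + 1).factorial * ∫⁻ s, φ s *
        ENNReal.ofReal ((Set.Icc (0 : ℝ) 1).indicator (marginalDensity k j) s) := by
  rw [setLIntegral_symmetric _ (by fun_prop)]
  · congr 1
    have h1 : ∀ y ∈ Set.Ici (0 : Fin (k + j + 1) → ℝ), φ (sumLargest k (partialSum y)) *
        ENNReal.ofReal (1 - ∑ i, partialSum y i) = φ (topForm k (k + j + 1) y) *
          ENNReal.ofReal (1 - (topForm k (k + j + 1) y + bottomForm k (k + j + 1) y)) := by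
      intro y hy
      rw [sumLargest_partialSum hk (by omega) hy, sum_partialSum k]
    rw [setLIntegral_congr_fun measurableSet_Ici h1, setLIntegral_topForm_bottomForm hk j
      (fun p => φ p.1 * ENNReal.ofReal (1 - (p.1 + p.2))) (by fun_prop), Measure.volume_eq_prod,
      lintegral_prod]
    · refine lintegral_congr fun s => ?_
      simp only [mul_assoc]
      rw [lintegral_const_mul, lintegral_range_marginal hk]
      have := (measurable_indicator_rangeSumDensity k j).comp (measurable_prodMk_left (x := s))
      exact Measurable.mul (by fun_prop) this
    · have := measurable_indicator_rangeSumDensity k j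
      exact (Measurable.mul (by fun_prop) this).aemeasurable
  · intro x σ
    rw [sumLargest_comp_perm]
    congr 3
    exact Equiv.sum_comp σ x

/-- The first sorting, applied to the sample. For given spacings g the smallest point ranges over
[0, 1 - Σ g], and the length of this interval is the weight in `setLIntegral_sumLargest_simplex`. -/
theorem setLIntegral_sumLargest_innerSpacing {k : ℕ} (hk : 1 ≤ k) (j : ℕ) (φ : ℝ → ℝ≥0∞)
    (hφ : Measurable φ) :
    ∫⁻ x in Set.Icc (0 : Fin (k + j + 2) → ℝ) 1, φ (sumLargest k (innerSpacing x)) =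
      (k + j + 2).factorial * (k + j + 1).factorial * ∫⁻ s, φ s *
        ENNReal.ofReal ((Set.Icc (0 : ℝ) 1).indicator (marginalDensity k j) s) := by
  have hmeas : Measurable fun x : Fin (k + j + 2) → ℝ => φ (sumLargest k (innerSpacing x)) := by
    fun_prop
  have hsimplex : Measurable fun p : ℝ × (Fin (k + j + 1) → ℝ) =>
      {p : ℝ × (Fin (k + j + 1) → ℝ) | p.1 ≤ 1 - ∑ i, p.2 i}.indicator
        (fun p => φ (sumLargest k p.2)) p :=
    (by fun_prop : Measurable fun p : ℝ × (Fin (k + j + 1) → ℝ) => φ (sumLargest k p.2)).indicator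
      (measurableSet_le (by fun_prop) (by fun_prop))
  rw [← Set.Ici_inter_Iic, Set.inter_comm, ← setLIntegral_indicator measurableSet_Iic,
    setLIntegral_symmetric _ (hmeas.indicator measurableSet_Iic)]
  · rw [mul_assoc, ← setLIntegral_sumLargest_simplex hk j φ hφ]
    congr 1
    rw [setLIntegral_Ici_cons (fun y : Fin (k + j + 1 + 1) → ℝ => (Set.Iic 1).indicator
      (fun x : Fin (k + j + 2) → ℝ => φ (sumLargest k (innerSpacing x))) (partialSum y))
      ((hmeas.indicator measurableSet_Iic).comp (measurable_partialSum _))]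
    have h1 : ∀ a ∈ Set.Ici (0 : ℝ), ∫⁻ y in Set.Ici (0 : Fin (k + j + 1) → ℝ),
        (Set.Iic 1).indicator (fun x => φ (sumLargest k (innerSpacing x)))
          (partialSum (Fin.cons a y : Fin (k + j + 2) → ℝ)) =
        ∫⁻ y in Set.Ici (0 : Fin (k + j + 1) → ℝ),
          {p : ℝ × (Fin (k + j + 1) → ℝ) | p.1 ≤ 1 - ∑ i, p.2 i}.indicator
            (fun p => φ (sumLargest k p.2)) (a, y) := by
      intro a ha
      refine setLIntegral_congr_fun measurableSet_Ici fun y hy => ?_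
      have h0 : (0 : Fin (k + j + 2) → ℝ) ≤ Fin.cons a y := by
        intro i
        refine Fin.cases ?_ (fun i => ?_) i
        · simpa using ha
        · simpa using hy i
      have hiff : partialSum (Fin.cons a y : Fin (k + j + 2) → ℝ) ∈ Set.Iic 1 ↔
          (a, y) ∈ {p : ℝ × (Fin (k + j + 1) → ℝ) | p.1 ≤ 1 - ∑ i, p.2 i} := by
        refine (partialSum_le_const_iff h0 1).trans ?_
        rw [Fin.sum_univ_succ]
        simp [le_sub_iff_add_le]
      by_cases hmem : (a, y) ∈ {p : ℝ × (Fin (k + j + 1) → ℝ) | p.1 ≤ 1 - ∑ i, p.2 i}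
      · simp only [Set.indicator_of_mem hmem, Set.indicator_of_mem (hiff.2 hmem)]
        rw [innerSpacing_partialSum h0]
        simp only [Fin.cons_succ]
      · simp only [Set.indicator_of_notMem hmem, Set.indicator_of_notMem (mt hiff.1 hmem)]
    rw [setLIntegral_congr_fun measurableSet_Ici h1, lintegral_lintegral_swap hsimplex.aemeasurable]
    refine lintegral_congr fun y => ?_
    have h2 : ∀ a : ℝ, {p : ℝ × (Fin (k + j + 1) → ℝ) | p.1 ≤ 1 - ∑ i, p.2 i}.indicator
        (fun p => φ (sumLargest k p.2)) (a, y) =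
        (Set.Iic (1 - ∑ i, y i)).indicator (fun _ => φ (sumLargest k y)) a := fun a => rfl
    simp only [h2]
    rw [setLIntegral_indicator measurableSet_Iic, setLIntegral_const, Set.inter_comm,
      Set.Ici_inter_Iic, Real.volume_Icc, sub_zero]
  · intro x σ
    have hiff : x ∘ σ ∈ Set.Iic (1 : Fin (k + j + 2) → ℝ) ↔ x ∈ Set.Iic 1 := by
      simp only [Set.mem_Iic, Pi.le_def, Pi.one_apply, Function.comp_apply]
      exact σ.forall_congr_left.trans (by simp)
    by_cases hx : x ∈ Set.Iic 1
    · rw [Set.indicator_of_mem hx, Set.indicator_of_mem (hiff.2 hx), innerSpacing_comp_perm]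
    · rw [Set.indicator_of_notMem hx, Set.indicator_of_notMem (mt hiff.1 hx)]

/-! ### The law of the statistic, up to evaluation of the marginal. -/

theorem map_eq_restrict_Icc_of_isUniform {Ω : Type*} [MeasurableSpace Ω] (P : Measure Ω)
    [IsProbabilityMeasure P] {n : ℕ} (X : Fin n → Ω → ℝ) (hmeas : ∀ i, Measurable (X i))
    (hunif : ∀ i, pdf.IsUniform (X i) (Set.Icc (0 : ℝ) 1) P volume) (hindep : iIndepFun X P) :
    P.map (fun ω i => X i ω) = volume.restrict (Set.Icc 0 1) := by
  have h1 : ∀ i, P.map (X i) = volume.restrict (Set.Icc 0 1) := by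
    intro i
    rw [hunif i, ProbabilityTheory.cond]
    simp
  rw [(iIndepFun_iff_map_fun_eq_pi_map fun i => (hmeas i).aemeasurable).1 hindep]
  simp only [h1]
  rw [← Measure.restrict_pi_pi, Set.pi_univ_Icc]
  rfl

theorem map_sumLargest_innerSpacing {Ω : Type*} [MeasurableSpace Ω] (P : Measure Ω)
    [IsProbabilityMeasure P] {k : ℕ} (hk : 1 ≤ k) (j : ℕ)
    (X : Fin (k + j + 2) → Ω → ℝ) (hmeas : ∀ i, Measurable (X i))
    (hunif : ∀ i, pdf.IsUniform (X i) (Set.Icc (0 : ℝ) 1) P volume)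
    (hindep : iIndepFun X P) :
    P.map (fun ω => sumLargest k (innerSpacing fun i => X i ω)) =
      volume.withDensity fun s => ENNReal.ofReal ((Set.Icc (0 : ℝ) 1).indicator
        (fun s => (k + j + 2).factorial * (k + j + 1).factorial * marginalDensity k j s) s) := by
  have hX : Measurable fun ω => fun i => X i ω := measurable_pi_lambda _ hmeas
  ext A hA
  rw [← lintegral_indicator_one hA, lintegral_map (measurable_one.indicator hA) (by fun_prop),
    withDensity_apply _ hA, ← lintegral_indicator hA]
  have h := lintegral_map (μ := P) (f := fun x : Fin (k + j + 2) → ℝ =>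
    A.indicator (1 : ℝ → ℝ≥0∞) (sumLargest k (innerSpacing x)))
    ((measurable_one.indicator hA).comp (by fun_prop)) hX
  rw [← h, map_eq_restrict_Icc_of_isUniform P X hmeas hunif hindep,
    setLIntegral_sumLargest_innerSpacing hk j _ (measurable_one.indicator hA),
    ← lintegral_const_mul' _ _ (by finiteness)]
  refine lintegral_congr fun s => ?_
  by_cases hs : s ∈ A
  · simp only [Set.indicator_of_mem hs]
    by_cases hs1 : s ∈ Set.Icc (0 : ℝ) 1
    · simp only [Set.indicator_of_mem hs1]
      rw [ENNReal.ofReal_mul (by positivity), ENNReal.ofReal_mul (by positivity)]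
      simp
    · simp only [Set.indicator_of_notMem hs1]
      simp
  · simp [Set.indicator_of_notMem hs]

/-! ### Evaluation of the closed forms. -/

theorem continuous_truncPow_succ (p : ℕ) : Continuous (truncPow (p + 1)) := by
  simp only [funext (truncPow_succ_eq p)]
  fun_prop

theorem mul_boxH_eq_truncPow {p : ℕ} {n k s : ℝ} (hn : 0 < n) (hs : s ≤ 1) :
    (s * n - k) ^ (p + 1) * boxH s (k / n) 1 = truncPow (p + 1) (s * n - k) := by
  have hiff : s ∈ Set.Icc (k / n) 1 ↔ 0 ≤ s * n - k := by
    rw [Set.mem_Icc, div_le_iff₀ hn, sub_nonneg]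
    exact and_iff_left hs
  unfold boxH truncPow
  by_cases h : 0 ≤ s * n - k
  · rw [Set.indicator_of_mem (hiff.2 h), if_pos h, mul_one]
  · rw [Set.indicator_of_notMem (mt hiff.1 h), if_neg h, mul_zero]

/-- With m = j + 1 = N - 1 - k, the reversal turns N - k - i into the i + 1 of `rangeSumDensity`. -/
theorem sum_Icc_one_eq_sum_range (m : ℕ) (f : ℕ → ℝ) :
    ∑ i ∈ Finset.Icc 1 m, f i = ∑ i ∈ Finset.range m, f (m - i) := by
  refine Finset.sum_nbij' (fun i => m - i) (fun i => m - i) ?_ ?_ ?_ ?_ ?_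
  all_goals
    intro i hi
    simp only [Finset.mem_Icc, Finset.mem_range] at hi ⊢
  · omega
  · omega
  · omega
  · omega
  · congr 1
    omega

/-- Substitute μ = s + v. The base of the power is negative beyond μ = s (k + r) / k, so the
truncation becomes the upper limit of integration. -/
theorem integral_one_sub_mul_truncPow (p : ℕ) {k r : ℝ} (hk : 0 < k) (hr : 0 < r) {s : ℝ}
    (hs : s ∈ Set.Icc (0 : ℝ) 1) :
    ∫ v in (0 : ℝ)..(1 - s), (1 - s - v) * truncPow p (s - k * v / r) =
      ∫ μ in s..min 1 (s * (k + r) / k), (1 - μ) * ((s * (k + r) - μ * k) / r) ^ p := by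
  have hn : 0 < k + r := by positivity
  have hmul : s ≤ s * (k + r) / k := by
    rw [le_div_iff₀ hk]
    nlinarith [mul_nonneg hs.1 hr.le]
  have hb : s ≤ min 1 (s * (k + r) / k) := le_min hs.2 hmul
  have hshift := intervalIntegral.integral_comp_add_left (a := 0) (b := 1 - s)
    (fun μ => (1 - μ) * truncPow p ((s * (k + r) - μ * k) / r)) s
  have harg : ∀ v : ℝ, (s * (k + r) - (s + v) * k) / r = s - k * v / r := by
    intro v
    field_simp
    ring
  have hint : ∀ a b, IntervalIntegrable
      (fun μ => (1 - μ) * truncPow p ((s * (k + r) - μ * k) / r)) volume a b := by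
    intro a b
    refine IntervalIntegrable.continuousOn_mul ?_ (by fun_prop)
    convert intervalIntegrable_truncPow_affine p (s * (k + r) / r) (-(k / r)) a b using 3
    ring
  simp only [harg, add_zero, add_sub_cancel] at hshift
  simp only [← sub_sub] at hshift
  rw [hshift, ← intervalIntegral.integral_add_adjacent_intervals
    (hint s (min 1 (s * (k + r) / k))) (hint _ 1)]
  have htail : ∫ μ in min 1 (s * (k + r) / k)..1,
      (1 - μ) * truncPow p ((s * (k + r) - μ * k) / r) = 0 := by
    rw [intervalIntegral.integral_of_le (min_le_left _ _)]
    refine setIntegral_eq_zero_of_forall_eq_zero fun μ hμ => ?_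
    have h1 : s * (k + r) / k < μ := by
      rcases min_lt_iff.1 hμ.1 with h | h
      · exact absurd hμ.2 h.not_ge
      · exact h
    rw [div_lt_iff₀ hk] at h1
    rw [truncPow_of_neg _ (div_neg_of_neg_of_pos (by linarith) hr), mul_zero]
  rw [htail, add_zero]
  refine intervalIntegral.integral_congr fun μ hμ => ?_
  rw [Set.uIcc_of_le hb] at hμ
  have h1 := (le_div_iff₀ hk).1 (hμ.2.trans (min_le_right _ _))
  rw [truncPow_of_nonneg _ (div_nonneg (by linarith) hr.le)]

/-- With u = (s (k + r) - μ k) / r, the factor 1 - μ is affine in u, and the primitive combines u ^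
(p + 1) and u ^ (p + 2). The lower limit is u = s. The upper limit is u = (s (k + r) - k) / r or u =
0, whichever is larger, and the truncated power covers both cases. -/
theorem integral_one_sub_mul_pow (p : ℕ) {k r : ℝ} (hk : 0 < k) (hr : 0 < r) (s : ℝ) :
    ∫ μ in s..min 1 (s * (k + r) / k), (1 - μ) * ((s * (k + r) - μ * k) / r) ^ p =
      1 / (k ^ 2 * (p + 1) * (p + 2) * r ^ p) *
        (s ^ (p + 1) * (k * (p + 2) - s * (k + r) - k * s * (p + 1)) * r ^ (p + 1) +
          truncPow (p + 2) (s * (k + r) - k)) := by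
  have hder : ∀ μ ∈ Set.uIcc s (min 1 (s * (k + r) / k)), HasDerivAt
      (fun μ => -(r / k) * ((k - s * (k + r)) / k * ((s * (k + r) - μ * k) / r) ^ (p + 1) / (p + 1) +
        r / k * ((s * (k + r) - μ * k) / r) ^ (p + 2) / (p + 2)))
      ((1 - μ) * ((s * (k + r) - μ * k) / r) ^ p) μ := by
    intro μ _
    have hu : HasDerivAt (fun μ => (s * (k + r) - μ * k) / r) (-(k / r)) μ := by
      have := (((hasDerivAt_id μ).mul_const k).const_sub (s * (k + r))).div_const r
      refine this.congr_deriv ?_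
      ring
    have h := ((((hu.pow (p + 1)).const_mul ((k - s * (k + r)) / k)).div_const ((p : ℝ) + 1)).add
      (((hu.pow (p + 2)).const_mul (r / k)).div_const ((p : ℝ) + 2))).const_mul (-(r / k))
    refine h.congr_deriv ?_
    have e1 : p + 1 - 1 = p := rfl
    have e2 : p + 2 - 1 = p + 1 := rfl
    rw [e1, e2]
    have hmu : 1 - μ = (k - s * (k + r)) / k + r / k * ((s * (k + r) - μ * k) / r) := by
      field_simp
      ring
    rw [hmu]
    generalize (s * (k + r) - μ * k) / r = u
    push_cast
    have : (p : ℝ) + 1 ≠ 0 := by positivity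
    have : (p : ℝ) + 2 ≠ 0 := by positivity
    field_simp
    ring
  rw [intervalIntegral.integral_eq_sub_of_hasDerivAt hder
    (Continuous.intervalIntegrable (by fun_prop) _ _)]
  have hp1 : (p : ℝ) + 1 ≠ 0 := by positivity
  have hp2 : (p : ℝ) + 2 ≠ 0 := by positivity
  have hs' : (s * (k + r) - s * k) / r = s := by
    field_simp
    ring
  have hlower : -(r / k) * ((k - s * (k + r)) / k * s ^ (p + 1) / (p + 1) +
      r / k * s ^ (p + 2) / (p + 2)) = -(1 / (k ^ 2 * (p + 1) * (p + 2) * r ^ p) *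
        (s ^ (p + 1) * (k * (p + 2) - s * (k + r) - k * s * (p + 1)) * r ^ (p + 1))) := by
    field_simp
    ring
  rw [hs', hlower]
  rcases le_total 1 (s * (k + r) / k) with h | h
  · have h0 : 0 ≤ s * (k + r) - k := by
      have := (le_div_iff₀ hk).1 h
      linarith
    rw [min_eq_left h, truncPow_of_nonneg _ h0, one_mul, ← neg_sub (s * (k + r)) k]
    generalize s * (k + r) - k = w
    have hupper : -(r / k) * (-w / k * (w / r) ^ (p + 1) / (p + 1) +
        r / k * (w / r) ^ (p + 2) / (p + 2)) =
        1 / (k ^ 2 * (p + 1) * (p + 2) * r ^ p) * w ^ (p + 2) := by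
      rw [div_pow, div_pow]
      field_simp
      ring
    rw [hupper]
    ring
  · have h0 : s * (k + r) - k ≤ 0 := by
      have := (div_le_iff₀ hk).1 h
      linarith
    rw [min_eq_right h, truncPow_of_nonpos _ h0, div_mul_cancel₀ _ hk.ne']
    simp

theorem coeff_eq_densityCoeff {k j i : ℕ} (hk : 1 ≤ k) (hij : i ≤ j) :
    ((k + j + 2 : ℕ) : ℝ) * (((k + j + 2 : ℕ) : ℝ) - 1) *
        coeffA (k + j + 2 - 1 - k) (k + j + 2 - 2) * coeffa (j + 1 - i) (k + j + 2 - 1 - k) =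
      (k + j + 2).factorial * (k + j + 1).factorial * densityCoeff k j i := by
  have h1 : k + j + 2 - 1 - k = j + 1 := by omega
  have h2 : k + j + 2 - 2 = k + j := rfl
  have h3 : k + j + 1 - (j + 1) = k := by omega
  have h4 : j + 1 - (j + 1 - i) = i := by omega
  have h5 : j + 1 - i - 1 = j - i := by omega
  have h6 : ((j + 1 : ℕ) : ℝ) + 1 - (j + 1 - i : ℕ) = i + 1 := by
    rw [Nat.cast_sub (by omega)]
    push_cast
    ring
  have h7 : ((k + j : ℕ) : ℝ) + 1 - (j + 1 : ℕ) = k := by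
    push_cast
    ring
  -- The integer exponent is -1 when j = 0; it matches the quotient (i + 1) ^ j / (i + 1) in
  -- `densityCoeff`.
  have h8 : ((j + 1 : ℕ) : ℤ) - 2 = (j : ℤ) - 1 := by
    push_cast
    ring
  have hi : (i : ℝ) + 1 ≠ 0 := by positivity
  obtain ⟨q, rfl⟩ := Nat.exists_eq_add_of_le' hk
  have h9 : q + 1 - 1 + j = q + j := rfl
  have h10 : (q + 1 + j + 2).factorial =
      (q + j + 3) * ((q + j + 2) * ((q + j + 1) * (q + j).factorial)) := by
    rw [show q + 1 + j + 2 = q + j + 1 + 1 + 1 by ring, Nat.factorial_succ, Nat.factorial_succ,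
      Nat.factorial_succ]
  have hk0 : ((q + 1 : ℕ) : ℝ) ≠ 0 := by positivity
  unfold coeffA coeffa densityCoeff
  rw [h1, h2, h3, h4, h5, h6, h7, h8, h9, h10, zpow_sub_one₀ hi, zpow_natCast, Nat.add_sub_cancel]
  generalize ((q + 1 : ℕ) : ℝ) = kk at *
  have : ((q + 1 + j : ℕ) : ℝ) = q + j + 1 := by push_cast; ring
  rw [this]
  have : ((q + 1 + j + 2 : ℕ) : ℝ) = q + j + 3 := by push_cast; ring
  rw [this]
  push_cast
  field_simp
  ring

theorem marginalDensity_eq_sum_integral {k : ℕ} (hk : 1 ≤ k) (j : ℕ) {s : ℝ}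
    (hs : s ∈ Set.Icc (0 : ℝ) 1) :
    marginalDensity k j s = ∑ i ∈ Finset.range (j + 1), densityCoeff k j i *
      ∫ μ in s..min 1 (s * (k + (i + 1)) / k),
        (1 - μ) * ((s * (k + (i + 1)) - μ * k) / (i + 1)) ^ (k - 1 + j) := by
  have hk0 : (0 : ℝ) < k := by positivity
  have h1 : ∀ v, (1 - s - v) * rangeSumDensity k j s v = ∑ i ∈ Finset.range (j + 1),
      densityCoeff k j i * ((1 - s - v) * truncPow (k - 1 + j) (s - k * v / (i + 1))) := by
    intro v
    rw [rangeSumDensity, Finset.mul_sum]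
    exact Finset.sum_congr rfl fun i _ => by ring
  unfold marginalDensity
  simp only [h1]
  rw [intervalIntegral.integral_finsetSum]
  · refine Finset.sum_congr rfl fun i _ => ?_
    rw [intervalIntegral.integral_const_mul,
      integral_one_sub_mul_truncPow _ hk0 (by positivity) hs]
  · intro i _
    refine IntervalIntegrable.const_mul (IntervalIntegrable.continuousOn_mul ?_ (by fun_prop)) _
    convert intervalIntegrable_truncPow_affine (k - 1 + j) s (-(k / ((i : ℝ) + 1))) 0 (1 - s) using 3
    ring

theorem integral_formula_eq_marginalDensity {k : ℕ} (hk : 1 ≤ k) (j : ℕ) {s : ℝ}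
    (hs : s ∈ Set.Icc (0 : ℝ) 1) {N : ℕ} (hN : N = k + j + 2) :
    (N : ℝ) * ((N : ℝ) - 1) * coeffA (N - 1 - k) (N - 2) *
          ∑ i ∈ Finset.Icc 1 (N - 1 - k),
            ∫ μ in s..min 1 (s * ((N : ℝ) - i) / k),
              coeffa i (N - 1 - k) * (1 - μ) *
                ((s * ((N : ℝ) - i) - μ * k) / ((N : ℝ) - k - i)) ^ (N - 3) =
      (k + j + 2).factorial * (k + j + 1).factorial * marginalDensity k j s := by
  subst hN
  rw [marginalDensity_eq_sum_integral hk j hs, sum_Icc_one_eq_sum_range, Finset.mul_sum,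
    Finset.mul_sum]
  have h1 : k + j + 2 - 1 - k = j + 1 := by omega
  refine Finset.sum_congr (by rw [h1]) fun i hi => ?_
  have hij : i ≤ j := by
    have := Finset.mem_range.1 hi
    omega
  have h2 : ((k + j + 2 : ℕ) : ℝ) - (j + 1 - i : ℕ) = k + (i + 1) := by
    rw [Nat.cast_sub (by omega)]
    push_cast
    ring
  have h3 : ((k + j + 2 : ℕ) : ℝ) - k - (j + 1 - i : ℕ) = i + 1 := by
    rw [sub_right_comm, h2]
    ring
  have h4 : k + j + 2 - 3 = k - 1 + j := by omega
  rw [← mul_assoc, ← coeff_eq_densityCoeff hk hij, h1, h2, h3, h4]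
  simp only [mul_assoc, intervalIntegral.integral_const_mul]

/-- The density with the indicator terms written as truncated powers. -/
theorem pdfSumMax_eq_truncPow {k : ℕ} (hk : 1 ≤ k) (j : ℕ) {s : ℝ} (hs : s ≤ 1) :
    pdfSumMax (k + j + 2) k s = ((k + j + 2 : ℕ) : ℝ) * coeffA (j + 1) (k + j) /
      ((k : ℝ) ^ 2 * (k + j)) * ∑ i ∈ Finset.range (j + 1), coeffa (j + 1 - i) (j + 1) /
        ((i : ℝ) + 1) ^ (k - 1 + j) *
        (s ^ (k + j) * (k * (k + j + 1) - s * (k + i + 1) - k * s * (k + j)) *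
          ((i : ℝ) + 1) ^ (k + j) + truncPow (k + j + 1) (s * (k + i + 1) - k)) := by
  have h1 : k + j + 2 - 1 - k = j + 1 := by omega
  have h0 : ((k + j + 2 : ℕ) : ℝ) - 2 = k + j := by push_cast; ring
  have h4 : k + j + 2 - 3 = k - 1 + j := by omega
  unfold pdfSumMax
  rw [sum_Icc_one_eq_sum_range, h1, h0, h4]
  congr 1
  refine Finset.sum_congr rfl fun i hi => ?_
  have hij : i ≤ j := by
    have := Finset.mem_range.1 hi
    omega
  have h2 : ((k + j + 2 : ℕ) : ℝ) - (j + 1 - i : ℕ) = k + i + 1 := by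
    rw [Nat.cast_sub (by omega)]
    push_cast
    ring
  have h3 : ((k + j + 2 : ℕ) : ℝ) - k - (j + 1 - i : ℕ) = i + 1 := by
    rw [sub_right_comm, h2]
    ring
  have h5 : (k : ℝ) + i + 1 - k = i + 1 := by ring
  have hn : (0 : ℝ) < k + i + 1 := by positivity

  rw [h2, h3, h5, show k + j + 2 - 1 = k + j + 1 from rfl, mul_boxH_eq_truncPow hn hs]
  push_cast
  congr 3
  ring

theorem cdfSumMax_eq_truncPow {k : ℕ} (hk : 1 ≤ k) (j : ℕ) {s : ℝ} (hs : s ≤ 1) :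
    cdfSumMax (k + j + 2) k s = ((k + j + 2 : ℕ) : ℝ) * coeffA (j + 1) (k + j) /
      ((k : ℝ) ^ 2 * (k + j)) * ∑ i ∈ Finset.range (j + 1), coeffa (j + 1 - i) (j + 1) /
        ((i : ℝ) + 1) ^ (k - 1 + j) *
        (s ^ (k + j + 1) * (k - s * (k * (k + j) + (k + i + 1)) / (k + j + 2)) *
          ((i : ℝ) + 1) ^ (k + j) + 1 / ((k + j + 2) * (k + i + 1)) *
            truncPow (k + j + 2) (s * (k + i + 1) - k)) := by
  have h1 : k + j + 2 - 1 - k = j + 1 := by omega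
  have h0 : ((k + j + 2 : ℕ) : ℝ) - 2 = k + j := by push_cast; ring
  have h4 : k + j + 2 - 3 = k - 1 + j := by omega
  unfold cdfSumMax
  rw [sum_Icc_one_eq_sum_range, h1, h0, h4]
  congr 1
  refine Finset.sum_congr rfl fun i hi => ?_
  have hij : i ≤ j := by
    have := Finset.mem_range.1 hi
    omega
  have h2 : ((k + j + 2 : ℕ) : ℝ) - (j + 1 - i : ℕ) = k + i + 1 := by
    rw [Nat.cast_sub (by omega)]
    push_cast
    ring
  have h3 : ((k + j + 2 : ℕ) : ℝ) - k - (j + 1 - i : ℕ) = i + 1 := by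
    rw [sub_right_comm, h2]
    ring
  have h5 : (k : ℝ) + i + 1 - k = i + 1 := by ring
  have hn : (0 : ℝ) < k + i + 1 := by positivity

  have h6 : ((k + j + 2 : ℕ) : ℝ) * (k + 1) - (j + 1 - i : ℕ) - 2 * k =
      k * (k + j) + (k + i + 1) := by
    rw [Nat.cast_sub (by omega)]
    push_cast
    ring
  rw [h6, h2, h3, h5, mul_assoc (1 / _), mul_boxH_eq_truncPow hn hs]
  push_cast
  rfl

theorem pdfSumMax_eq_marginalDensity {k : ℕ} (hk : 1 ≤ k) (j : ℕ) {s : ℝ}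
    (hs : s ∈ Set.Icc (0 : ℝ) 1) :
    pdfSumMax (k + j + 2) k s =
      (k + j + 2).factorial * (k + j + 1).factorial * marginalDensity k j s := by
  have hk0 : (0 : ℝ) < k := by positivity
  rw [pdfSumMax_eq_truncPow hk j hs.2, marginalDensity_eq_sum_integral hk j hs, Finset.mul_sum,
    Finset.mul_sum]
  refine Finset.sum_congr rfl fun i hi => ?_
  have hij : i ≤ j := by
    have := Finset.mem_range.1 hi
    omega
  have hc := coeff_eq_densityCoeff hk hij
  have h1 : k + j + 2 - 1 - k = j + 1 := by omega
  have h2 : k + j + 2 - 2 = k + j := rfl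
  rw [h1, h2] at hc
  rw [← mul_assoc (_ * _) (densityCoeff k j i), ← hc, integral_one_sub_mul_pow _ hk0 (by positivity)]
  obtain ⟨q, rfl⟩ := Nat.exists_eq_add_of_le' hk
  have h3 : q + 1 - 1 + j = q + j := rfl
  have h4 : q + 1 + j = q + j + 1 := by ring
  rw [h3, h4]
  have h5 : s * (((q + 1 : ℕ) : ℝ) + (i + 1)) = s * ((q + 1 : ℕ) + i + 1) := by ring
  rw [h5]
  generalize truncPow (q + j + 1 + 1) _ = T
  generalize coeffA _ _ = A
  generalize coeffa _ _ = a
  push_cast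
  have : (q : ℝ) + 1 ≠ 0 := by positivity
  have : (q : ℝ) + 1 + j ≠ 0 := by positivity
  have : (q : ℝ) + j + 1 ≠ 0 := by positivity
  have : (q : ℝ) + j + 2 ≠ 0 := by positivity
  have : (i : ℝ) + 1 ≠ 0 := by positivity
  field_simp
  ring

theorem integral_pdfSumMax {k : ℕ} (hk : 1 ≤ k) (j : ℕ) {s : ℝ} (hs : s ∈ Set.Icc (0 : ℝ) 1) :
    IntervalIntegrable (pdfSumMax (k + j + 2) k) volume 0 s ∧
      ∫ x in (0 : ℝ)..s, pdfSumMax (k + j + 2) k x = cdfSumMax (k + j + 2) k s := by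
  have hpdf : Set.EqOn (pdfSumMax (k + j + 2) k) (fun s => ((k + j + 2 : ℕ) : ℝ) *
      coeffA (j + 1) (k + j) / ((k : ℝ) ^ 2 * (k + j)) * ∑ i ∈ Finset.range (j + 1),
        coeffa (j + 1 - i) (j + 1) / ((i : ℝ) + 1) ^ (k - 1 + j) *
        (s ^ (k + j) * (k * (k + j + 1) - s * (k + i + 1) - k * s * (k + j)) *
          ((i : ℝ) + 1) ^ (k + j) + truncPow (k + j + 1) (s * (k + i + 1) - k)))
      (Set.uIcc 0 s) := by
    intro x hx
    rw [Set.uIcc_of_le hs.1] at hx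
    exact pdfSumMax_eq_truncPow hk j (hx.2.trans hs.2)
  have hT := continuous_truncPow_succ (k + j)
  constructor
  · refine IntervalIntegrable.congr (hpdf.symm.mono Set.uIoc_subset_uIcc)
      (Continuous.intervalIntegrable (by fun_prop) _ _)
  · rw [intervalIntegral.integral_congr hpdf, cdfSumMax_eq_truncPow hk j hs.2,
      intervalIntegral.integral_const_mul, intervalIntegral.integral_finsetSum fun i _ =>
        Continuous.intervalIntegrable (by fun_prop) _ _]
    congr 1
    refine Finset.sum_congr rfl fun i _ => ?_
    have hn : (k : ℝ) + i + 1 ≠ 0 := by positivity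
    rw [intervalIntegral.integral_const_mul, intervalIntegral.integral_add
      (Continuous.intervalIntegrable (by fun_prop) _ _)
      (Continuous.intervalIntegrable (by fun_prop) _ _)]
    congr 2
    -- The two terms in x ^ (k + j + 1) of the integrand combine into the coefficient k (k + j) + (k
    -- + i + 1).
    · have hd : ∀ x ∈ Set.uIcc 0 s, HasDerivAt
          (fun x => (k * x ^ (k + j + 1) - (k * (k + j) + (k + i + 1)) / (k + j + 2) *
            x ^ (k + j + 2)) * ((i : ℝ) + 1) ^ (k + j))
          (x ^ (k + j) * (k * (k + j + 1) - x * (k + i + 1) - k * x * (k + j)) *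
            ((i : ℝ) + 1) ^ (k + j)) x := by
        intro x _
        refine ((((hasDerivAt_pow (k + j + 1) x).const_mul (k : ℝ)).sub
          ((hasDerivAt_pow (k + j + 2) x).const_mul
            ((k * (k + j) + (k + i + 1)) / (k + j + 2) : ℝ))).mul_const _).congr_deriv ?_
        rw [show k + j + 1 - 1 = k + j from rfl, show k + j + 2 - 1 = k + j + 1 from rfl]
        push_cast
        have : (k : ℝ) + j + 2 ≠ 0 := by positivity
        field_simp
        ring
      rw [intervalIntegral.integral_eq_sub_of_hasDerivAt hd
        (Continuous.intervalIntegrable (by fun_prop) _ _)]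
      simp only [ne_eq, Nat.add_eq_zero_iff, one_ne_zero, and_false, not_false_eq_true, zero_pow,
        OfNat.ofNat_ne_zero]
      ring
    · have h : ∀ x : ℝ, x * (k + i + 1) - k = -k + (k + i + 1) * x := fun x => by ring
      simp only [h]
      -- At x = 0 the truncated power has argument -k ≤ 0 and contributes nothing.
      rw [integral_truncPow_affine _ _ _ hn,
        truncPow_of_nonpos _ (show -(k : ℝ) ≤ 0 by simp), sub_zero]
      push_cast
      rw [show (k : ℝ) + j + 1 + 1 = k + j + 2 by ring]
      ring

theorem marginalDensity_nonneg {k : ℕ} (hk : 1 ≤ k) (j : ℕ) {s : ℝ} (hs : s ∈ Set.Icc (0 : ℝ) 1) :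
    0 ≤ marginalDensity k j s :=
  intervalIntegral.integral_nonneg (by linarith [hs.2]) fun v hv =>
    mul_nonneg (by linarith [hv.2]) (rangeSumDensity_nonneg hk j s hv.1)

theorem mainTheorem5 {Ω : Type*} [MeasurableSpace Ω] (P : Measure Ω) [IsProbabilityMeasure P]
    (N k : ℕ) (hk : 1 ≤ k) (hkN : k + 2 ≤ N)
    (X : Fin N → Ω → ℝ) (hmeas : ∀ i, Measurable (X i))
    (hunif : ∀ i, pdf.IsUniform (X i) (Set.Icc (0 : ℝ) 1) P volume)
    (hindep : iIndepFun X P) :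
    -- the closed form, extended by zero outside `[0, 1]`, is a density of the law
    P.map (fun ω => sumLargest k (innerSpacing (fun i => X i ω))) =
        volume.withDensity
          (fun s => ENNReal.ofReal ((Set.Icc (0 : ℝ) 1).indicator (pdfSumMax N k) s)) ∧
    (∀ s ∈ Set.Icc (0 : ℝ) 1, 0 ≤ pdfSumMax N k s) ∧
    -- the closed form is the marginal over the range `μ` of the sample
    (∀ s ∈ Set.Icc (0 : ℝ) 1, pdfSumMax N k s =
        (N : ℝ) * ((N : ℝ) - 1) * coeffA (N - 1 - k) (N - 2) *
          ∑ i ∈ Finset.Icc 1 (N - 1 - k),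
            ∫ μ in s..min 1 (s * ((N : ℝ) - i) / k),
              coeffa i (N - 1 - k) * (1 - μ) *
                ((s * ((N : ℝ) - i) - μ * k) / ((N : ℝ) - k - i)) ^ (N - 3)) ∧
    -- the cumulative distribution function
    (∀ s ∈ Set.Icc (0 : ℝ) 1,
        P.real {ω | sumLargest k (innerSpacing (fun i => X i ω)) ≤ s} = cdfSumMax N k s) := by
  obtain ⟨j, hj⟩ := Nat.exists_eq_add_of_le hkN
  -- Here j + 1 = N - 1 - k is the number of spacings left out of the sum.
  obtain rfl : N = k + j + 2 := by omega
  have hnn : ∀ s ∈ Set.Icc (0 : ℝ) 1, 0 ≤ pdfSumMax (k + j + 2) k s := fun s hs => by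
    rw [pdfSumMax_eq_marginalDensity hk j hs]
    exact mul_nonneg (by positivity) (marginalDensity_nonneg hk j hs)
  have hlaw : P.map (fun ω => sumLargest k (innerSpacing (fun i => X i ω))) =
      volume.withDensity (fun s => ENNReal.ofReal
        ((Set.Icc (0 : ℝ) 1).indicator (pdfSumMax (k + j + 2) k) s)) := by
    rw [map_sumLargest_innerSpacing P hk j X hmeas hunif hindep]
    congr with s
    congr 1
    exact Set.indicator_congr (fun x hx => (pdfSumMax_eq_marginalDensity hk j hx).symm) ▸ rfl
  refine ⟨hlaw, hnn, fun s hs => ?_, fun s hs => ?_⟩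
  · rw [integral_formula_eq_marginalDensity hk j hs rfl, pdfSumMax_eq_marginalDensity hk j hs]
  · have hX : Measurable fun ω => fun i => X i ω := measurable_pi_lambda _ hmeas
    have hS : Measurable fun ω => sumLargest k (innerSpacing (fun i => X i ω)) := by fun_prop
    have hP : P {ω | sumLargest k (innerSpacing (fun i => X i ω)) ≤ s} =
        ENNReal.ofReal (cdfSumMax (k + j + 2) k s) := by
      change P ((fun ω => sumLargest k (innerSpacing (fun i => X i ω))) ⁻¹' Set.Iic s) = _
      obtain ⟨hint, hval⟩ := integral_pdfSumMax hk j hs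
      rw [← Measure.map_apply hS measurableSet_Iic, hlaw, withDensity_apply _ measurableSet_Iic,
        ← hval, ← setLIntegral_Ici_indicator_Iic hs.1 hint fun a ha => hnn a ⟨ha.1, ha.2.trans hs.2⟩,
        ← lintegral_indicator measurableSet_Iic, ← lintegral_indicator measurableSet_Ici]
      refine lintegral_congr fun x => ?_
      by_cases h1 : x ≤ s
      · by_cases h0 : 0 ≤ x
        · simp [h1, h0, h1.trans hs.2]
        · simp [h0]
      · simp [Set.indicator, h1]
    rw [measureReal_def, hP, ENNReal.toReal_ofReal]
    -- Returning to real numbers requires `cdfSumMax` to be nonnegative, which holds because it is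
    -- an integral of the nonnegative density.
    rw [← (integral_pdfSumMax hk j hs).2]
    exact intervalIntegral.integral_nonneg hs.1 fun a ha => hnn a ⟨ha.1, ha.2.trans hs.2⟩
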